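/- Let $B=(b_1,b_2,b_3)\in\mathbb{R}^3$ with $|B|=1$ and $b_2>0$, and let $A:\mathbb{R}^3\to\mathbb{R}^3$ be any linear vector field with $\operatorname{curl}A=B$. For $\alpha\in(0,\pi)$ let $\mathcal{W}_\alpha=\{x\in\mathbb{R}^3:\ |x_2|\le x_1\tan\frac{\alpha}{2}\}$ be the infinite wedge of opening $\alpha$, and let $E(B,\mathcal{W}_\alpha)$ be the bottom of the spectrum of the Neumann magnetic Laplacian $(-i\nabla-A)^2$ on $\mathcal{W}_\alpha$, i.e. of the self-adjoint operator on $L^2(\mathcal{W}_\alpha)$ associated with the closed quadratic form $u\mapsto\int_{\mathcal{W}_\alpha}|(-i\nabla-A)u|^2\,dx$ with domain $\{u\in L^2(\mathcal{W}_\alpha):\ (-i\nabla-A)u\in L^2(\mathcal{W}_\alpha)^3\}$ (by gauge invariance it depends on $A$ only through $B$). For $\tau\in\mathbb{R}$ let $\zeta(\tau)$ be the first eigenvalue of the self-adjoint operator on $L^2(\mathbb{R}_+,r\,dr)$ associated with the closed quadratic form $u\mapsto\int_0^\infty\left(|u'(r)|^2+(r-\tau)^2|u(r)|^2\right)r\,dr$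 with domain $\{u\in L^2(\mathbb{R}_+,r\,dr):\ u'\in L^2(\mathbb{R}_+,r\,dr),\ ru\in L^2(\mathbb{R}_+,r\,dr)\}$, and let $\Xi_0=\inf_{\tau\in\mathbb{R}}\zeta(\tau)$. Then $$\limsup_{\alpha\to0^+}E(B,\mathcal{W}_\alpha)\le b_2\,\Xi_0 .$$ -/

import Mathlib

noncomputable section

namespace MagneticWedge

open MeasureTheory Filter Topology
open scoped ContDiff

/-! ### Operators associated with quadratic forms, and their spectra

Unbounded operators are represented by their graphs. -/

section Operators

variable {H K : Type*} [NormedAddCommGroup H] [InnerProductSpace ℂ H]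
  [NormedAddCommGroup K] [InnerProductSpace ℂ K]

/-- Let `T` be the graph of a linear operator `H ⊇ Dom T → K`. This is the graph of the operator
`L` on `H` associated with the quadratic form `q(u) = ‖T u‖²` on the form domain `Dom T`:
`u ∈ Dom L` and `L u = f` if and only if `u ∈ Dom T` and
`⟪T v, T u⟫ = ⟪v, f⟫` for all `v ∈ Dom T`. -/
def formOperator (T : Set (H × K)) : Set (H × H) :=
  {p | ∃ w : K, (p.1, w) ∈ T ∧
    ∀ (v : H) (z : K), (v, z) ∈ T → inner ℂ z w = inner ℂ v p.2}

/-- The resolvent set of the operator with graph `L`: the `μ : ℂ` for which `L - μ` is a bijection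
from `Dom L` onto `H` with a bounded inverse `R`. -/
def resolventOf (L : Set (H × H)) : Set ℂ :=
  {μ | ∃ R : H →L[ℂ] H,
    (∀ g : H, (R g, g + μ • R g) ∈ L) ∧
    (∀ u f : H, (u, f) ∈ L → R (f - μ • u) = u)}

/-- The spectrum of the operator with graph `L`. -/
def spectrumOf (L : Set (H × H)) : Set ℂ := (resolventOf L)ᶜ

/-- The bottom of the spectrum of a self-adjoint operator (its spectrum is real), as an extended
real number; the infimum of the empty set is `⊤`. -/
def bottomOfSpectrum (L : Set (H × H)) : EReal :=
  ⨅ (t : ℝ) (_ : (t : ℂ) ∈ spectrumOf L), (t : EReal)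

/-- The real number `t` is an eigenvalue of the operator with graph `L`. -/
def IsEigenvalue (L : Set (H × H)) (t : ℝ) : Prop :=
  ∃ u : H, u ≠ 0 ∧ (u, (t : ℂ) • u) ∈ L

/-- The lowest eigenvalue of a self-adjoint operator, as an extended real number. -/
def firstEigenvalue (L : Set (H × H)) : EReal :=
  ⨅ (t : ℝ) (_ : IsEigenvalue L t), (t : EReal)

end Operators

/-! ### Weak derivatives -/

/-- On the open set `Ω`, the function `v` is the weak derivative of `u` in the direction `e`
(both are meant to be locally integrable on `Ω`). -/
def HasWeakDeriv {E : Type*} [NormedAddCommGroup E] [NormedSpace ℝ E] [MeasureSpace E]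
    (Ω : Set E) (e : E) (u v : E → ℂ) : Prop :=
  ∀ φ : E → ℂ, ContDiff ℝ ∞ φ → HasCompactSupport φ → tsupport φ ⊆ Ω →
    ∫ x in Ω, u x * fderiv ℝ φ x e = -∫ x in Ω, v x * φ x

/-! ### The magnetic Laplacian with natural Neumann boundary condition -/

/-- Three-dimensional Euclidean space; `x 0`, `x 1`, `x 2` are the coordinates `x₁`, `x₂`, `x₃`. -/
abbrev Space := EuclideanSpace ℝ (Fin 3)

/-- The `j`-th vector of the canonical basis. -/
def stdVec (j : Fin 3) : Space := EuclideanSpace.single j (1 : ℝ)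

/-- The (constant) curl of a linear vector field `A = (a₁, a₂, a₃)`; here
`∂ᵢ aⱼ = (A eᵢ)ⱼ`. -/
def curl (A : Space →ₗ[ℝ] Space) : Space :=
  !₂[A (stdVec 1) 2 - A (stdVec 2) 1,
     A (stdVec 2) 0 - A (stdVec 0) 2,
     A (stdVec 0) 1 - A (stdVec 1) 0]

/-- `L²(Ω)`, complex valued, for Lebesgue measure. -/
abbrev L2 (Ω : Set Space) := Lp ℂ 2 (volume.restrict Ω)

/-- The graph of the magnetic gradient `u ↦ (-i∇ - A) u` on the open set `Ω`, with the maximal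
domain `{u ∈ L²(Ω) | (-i∇ - A) u ∈ L²(Ω)³}`. The equation `-i ∂ⱼ u - aⱼ u = wⱼ` is written
as `∂ⱼ u = i (wⱼ + aⱼ u)`. -/
def magneticGradient (A : Space →ₗ[ℝ] Space) (Ω : Set Space) :
    Set (L2 Ω × PiLp 2 (fun _ : Fin 3 => L2 Ω)) :=
  {p | ∀ j : Fin 3, HasWeakDeriv Ω (stdVec j) (p.1 : Space → ℂ)
    (fun x => Complex.I * ((p.2 j : Space → ℂ) x + ((A x j : ℝ) : ℂ) * (p.1 : Space → ℂ) x))}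

/-- The Neumann magnetic Laplacian `H(A, Ω) = (-i∇ - A)²` on the open set `Ω`: the self-adjoint
operator associated with the form `u ↦ ∫_Ω |(-i∇ - A) u|²` on its maximal domain. -/
def magneticLaplacian (A : Space →ₗ[ℝ] Space) (Ω : Set Space) : Set (L2 Ω × L2 Ω) :=
  formOperator (magneticGradient A Ω)

/-- The bottom of the spectrum of `H(A, Ω)`. -/
def groundEnergy (A : Space →ₗ[ℝ] Space) (Ω : Set Space) : EReal :=
  bottomOfSpectrum (magneticLaplacian A Ω)

/-- The closed wedge of opening `α ∈ (0, 2π)`: the product of the sector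
`|x₂| ≤ x₁ tan (α/2)` (if `α < π`), the half-plane `0 ≤ x₁` (if `α = π`), or the sector
`|x₂| ≥ x₁ tan (α/2)` (if `π < α`), and of the real line. -/
def wedge (α : ℝ) : Set Space :=
  {x | (α < Real.pi ∧ |x 1| ≤ x 0 * Real.tan (α / 2)) ∨
       (α = Real.pi ∧ 0 ≤ x 0) ∨
       (Real.pi < α ∧ x 0 * Real.tan (α / 2) ≤ |x 1|)}

/-! ### The auxiliary problem on the half-line -/

/-- The measure `r dr` on `(0, ∞)`. -/
def radialMeasure : Measure ℝ :=
  (volume.restrict (Set.Ioi (0 : ℝ))).withDensity (fun r => ENNReal.ofReal r)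

/-- `L²_r(ℝ₊)`, complex valued: square integrable functions for the weight `r dr`. -/
abbrev L2r := Lp ℂ 2 radialMeasure

/-- The graph of `u ↦ (u', (r - τ) u)` from `L²_r(ℝ₊)` to `L²_r(ℝ₊)²` with the maximal domain.
As `u ∈ L²_r`, the condition `(r - τ) u ∈ L²_r` is the same as `r u ∈ L²_r`, so that the domain
is `B¹_r(ℝ₊) = {u ∈ L²_r | u' ∈ L²_r, r u ∈ L²_r}`. -/
def radialGradient (τ : ℝ) : Set (L2r × PiLp 2 (fun _ : Fin 2 => L2r)) :=
  {p | HasWeakDeriv (Set.Ioi (0 : ℝ)) 1 (p.1 : ℝ → ℂ) (p.2 0 : ℝ → ℂ) ∧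
    (p.2 1 : ℝ → ℂ) =ᵐ[radialMeasure] fun r => ((r - τ : ℝ) : ℂ) * (p.1 : ℝ → ℂ) r}

/-- The self-adjoint operator `𝔤_τ` associated with the closed quadratic form
`u ↦ ∫₀^∞ (|u'(r)|² + (r - τ)² |u(r)|²) r dr` on `B¹_r(ℝ₊)`. -/
def radialOperator (τ : ℝ) : Set (L2r × L2r) := formOperator (radialGradient τ)

/-- `ζ(τ)`, the first eigenvalue of `𝔤_τ`. -/
def zeta (τ : ℝ) : EReal := firstEigenvalue (radialOperator τ)

/-- The constant `Ξ₀ = inf_τ ζ(τ)`. -/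
def Xi0 : EReal := ⨅ τ : ℝ, zeta τ

end MagneticWedge

end

/-! The bound is variational. Write b = curl A, T = tan(α/2), and use coordinates x₁, x₂, x₃. The
slice of the wedge at abscissa x₁ = r is an interval of length 2Tr, so a function of x₁ alone is
integrated against 2T r dr: this is where the weight of the radial problem comes from.

A quadratic gauge φ turns A into A − ∇φ = (−b₃x₂, 0, b₁x₂ − b₂x₁ + σ). On the wedge |x₂| ≤ T x₁, so
for small T only the entry σ − b₂x₁ matters, and the effective energy of a profile V(x₁) is |V'|² +
(b₂r − σ)²|V|². Taking V to be a radial eigenfunction for an eigenvalue t, dilated by √b₂, makes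
this energy b₂ t ‖V‖². A Gaussian of width κ^(-1/2) in x₃ makes the trial function e^{iφ}
e^{−κx₃²/2} V(x₁) square integrable at a cost of order κ.

`groundEnergy_openWedge_le` gives the resulting Rayleigh quotient, with Young's inequality
(parameter δ) absorbing the cross terms. Letting T tend to 0 with δ and κ small gives
`limsup_groundEnergy_le` for every τ and every eigenvalue t; an infimum over both finishes.

The spectrum is defined through resolvents, so the min-max upper bound has to be proved:
`bottomOfSpectrum_le` derives it for the form ‖Tu‖² of any operator T with closed graph, and
`isClosed_magneticGraph` makes it applicable. -/

noncomputable section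

namespace MagneticWedge

open MeasureTheory Filter Topology
open scoped ContDiff

/-! ### Rayleigh quotients bound the bottom of the spectrum of a form operator. -/

section Spectral

variable {H K : Type*} [NormedAddCommGroup H] [InnerProductSpace ℂ H]
  [NormedAddCommGroup K] [InnerProductSpace ℂ K]

/-- The first projection of a subspace `G` of the Hilbert sum `H ⊕ K`. -/
def graphFst (G : Submodule ℂ (WithLp 2 (H × K))) : G →L[ℂ] H :=
  (WithLp.fstL 2 ℂ H K).comp G.subtypeL

@[simp]
theorem graphFst_apply (G : Submodule ℂ (WithLp 2 (H × K))) (p : G) :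
    graphFst G p = (p : WithLp 2 (H × K)).fst := rfl

theorem norm_graphFst_le (G : Submodule ℂ (WithLp 2 (H × K))) : ‖graphFst G‖ ≤ 1 := by
  refine ContinuousLinearMap.opNorm_le_bound _ zero_le_one fun p => ?_
  rw [one_mul, graphFst_apply]
  exact WithLp.norm_fst_le _ _

variable [CompleteSpace H] (G : Submodule ℂ (WithLp 2 (H × K))) [CompleteSpace G]

/-- The inverse of `L + 1`, where `L` is the operator associated with the form `‖T u‖²` and `G`
is the graph of `T`. -/
def graphResolvent : H →L[ℂ] H :=
  (graphFst G).comp (ContinuousLinearMap.adjoint (graphFst G))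

theorem inner_adjoint_graphFst (p : G) (g : H) :
    inner ℂ (p : WithLp 2 (H × K)) (ContinuousLinearMap.adjoint (graphFst G) g : G)
      = inner ℂ (p : WithLp 2 (H × K)).fst g :=
  ContinuousLinearMap.adjoint_inner_right (graphFst G) p g

/-- With P the first projection of the graph, the vector P*g represents v ↦ ⟪v, g⟫ for the graph
inner product ⟪v, u⟫ + ⟪Tv, Tu⟫. This is the weak form of (L + 1)u = g, so PP* inverts L + 1. -/
theorem graphResolvent_mem (g : H) :
    (graphResolvent G g, g - graphResolvent G g) ∈
      formOperator {p : H × K | WithLp.toLp 2 p ∈ G} := by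
  set q : G := ContinuousLinearMap.adjoint (graphFst G) g with hq
  refine ⟨(q : WithLp 2 (H × K)).snd, q.2, fun v z hvz => ?_⟩
  have h := inner_adjoint_graphFst G ⟨_, hvz⟩ g
  rw [← hq, WithLp.prod_inner_apply] at h
  rw [inner_sub_right, eq_sub_iff_add_eq']
  exact h

theorem graphResolvent_eq {u f : H}
    (h : (u, f) ∈ formOperator {p : H × K | WithLp.toLp 2 p ∈ G}) :
    graphResolvent G (f + u) = u := by
  obtain ⟨w, hw, hf⟩ := h
  have : ContinuousLinearMap.adjoint (graphFst G) (f + u) = ⟨WithLp.toLp 2 (u, w), hw⟩ := by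
    refine ext_inner_left ℂ fun p => ?_
    rw [ContinuousLinearMap.adjoint_inner_right, Submodule.coe_inner, WithLp.prod_inner_apply,
      inner_add_right, add_comm]
    congr 1
    exact (hf _ _ p.2).symm
  rw [graphResolvent, ContinuousLinearMap.comp_apply, this]
  rfl

theorem notMem_spectrum_graphResolvent {t : ℝ} (ht : 0 ≤ t)
    (h : (t : ℂ) ∈ resolventOf (formOperator {p : H × K | WithLp.toLp 2 p ∈ G})) :
    (((1 + t)⁻¹ : ℝ) : ℂ) ∉ spectrum ℂ (graphResolvent G) := by
  obtain ⟨S, hS, hS'⟩ := h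
  have h0 : (t : ℂ) + 1 ≠ 0 := by
    norm_cast
    positivity
  have h0' : 1 + (t : ℂ) ≠ 0 := by rwa [add_comm]
  rw [spectrum.notMem_iff]
  set R := graphResolvent G
  have e1 : ∀ g, R (g + ((t : ℂ) + 1) • S g) = S g := fun g => by
    have := graphResolvent_eq G (hS g)
    rwa [add_assoc, ← one_smul ℂ (S g), smul_smul, mul_one, ← add_smul, one_smul] at this
  have e2 : ∀ g, S (g - ((t : ℂ) + 1) • R g) = R g := fun g => by
    have := hS' _ _ (graphResolvent_mem G g)
    rw [← this]
    congr 1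
    rw [this, add_smul, one_smul]
    abel
  have e1' : ∀ g, R g + ((t : ℂ) + 1) • R (S g) = S g := fun g => by simpa using e1 g
  have e2' : ∀ g, S g - ((t : ℂ) + 1) • S (R g) = R g := fun g => by simpa using e2 g
  -- Functional calculus suggests the inverse: with R = (L+1)⁻¹ and S = (L−t)⁻¹, (1+t)⁻¹ − R =
  -- (L−t)/((1+t)(L+1)), whose inverse is (1+t)(1 + (1+t)S).
  refine ⟨⟨algebraMap ℂ _ (((1 + t)⁻¹ : ℝ) : ℂ) - R,
    ((t : ℂ) + 1) • (1 + ((t : ℂ) + 1) • S), ?_, ?_⟩, rfl⟩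
  · ext g
    have := e1' g
    rw [← eq_sub_iff_add_eq] at this
    simp only [mul_apply_eq_comp, sub_apply,
      ContinuousLinearMap.algebraMap_apply, smul_apply,
      add_apply, one_apply_eq_self, map_smul, map_add, this]
    push_cast
    match_scalars <;> field_simp <;> ring
  · ext g
    have := e2' g
    rw [sub_eq_iff_eq_add] at this
    simp only [mul_apply_eq_comp, sub_apply,
      ContinuousLinearMap.algebraMap_apply, smul_apply,
      add_apply, one_apply_eq_self, map_smul, map_sub, this]
    push_cast
    match_scalars <;> field_simp <;> ring

theorem graphResolvent_nonneg : 0 ≤ graphResolvent G := by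
  rw [ContinuousLinearMap.nonneg_iff_isPositive]
  exact ContinuousLinearMap.isPositive_self_comp_adjoint _

theorem norm_graphResolvent : ‖graphResolvent G‖ = ‖graphFst G‖ * ‖graphFst G‖ := by
  have := ContinuousLinearMap.norm_adjoint_comp_self (ContinuousLinearMap.adjoint (graphFst G))
  rwa [ContinuousLinearMap.adjoint_adjoint, LinearIsometryEquiv.norm_map] at this

/-- The bottom of the spectrum is bounded by the Rayleigh quotients of the quadratic form. -/
theorem bottomOfSpectrum_le {u : H} {w : K} (hu : u ≠ 0) (huw : WithLp.toLp 2 (u, w) ∈ G) {c : ℝ}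
    (hc : ‖w‖ ^ 2 ≤ c * ‖u‖ ^ 2) :
    bottomOfSpectrum (formOperator {p : H × K | WithLp.toLp 2 p ∈ G}) ≤ (c : EReal) := by
  have : Nontrivial H := ⟨u, 0, hu⟩
  have hu' : 0 < ‖u‖ ^ 2 := by positivity
  have hle : ‖u‖ ≤ ‖graphFst G‖ * ‖(⟨WithLp.toLp 2 (u, w), huw⟩ : G)‖ :=
    (graphFst G).le_opNorm (⟨WithLp.toLp 2 (u, w), huw⟩ : G)
  -- Since ‖PP*‖ = ‖P‖², testing P on the graph element (u, w) bounds the norm of the resolvent from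
  -- below.
  have hsq : ‖u‖ ^ 2 ≤ ‖graphResolvent G‖ * (‖u‖ ^ 2 + ‖w‖ ^ 2) := by
    have h2 : ‖(⟨WithLp.toLp 2 (u, w), huw⟩ : G)‖ ^ 2 = ‖u‖ ^ 2 + ‖w‖ ^ 2 :=
      WithLp.prod_norm_sq_eq_of_L2 _
    rw [norm_graphResolvent, ← h2]
    calc ‖u‖ ^ 2 ≤ _ := pow_le_pow_left₀ (norm_nonneg _) hle 2
      _ = _ := by ring
  set s := ‖graphResolvent G‖ with hs
  have hs1 : s ≤ 1 := by
    rw [hs, norm_graphResolvent]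
    exact mul_le_one₀ (norm_graphFst_le G) (norm_nonneg (graphFst G)) (norm_graphFst_le G)
  have hs0 : 0 ≤ s := norm_nonneg _
  have h1 : 1 ≤ s * (1 + c) := by
    refine le_of_mul_le_mul_right ?_ hu'
    nlinarith
  have hspos : 0 < s := by
    rcases hs0.eq_or_lt with h | h
    · rw [← h] at h1
      linarith
    · exact h
  -- The norm of a positive operator belongs to its spectrum; this supplies an actual spectral
  -- point.
  have hmem : s ∈ spectrum ℝ (graphResolvent G) :=
    CStarAlgebra.norm_mem_spectrum_of_nonneg (graphResolvent_nonneg G)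
  have hmem' : ((s : ℝ) : ℂ) ∈ spectrum ℂ (graphResolvent G) :=
    spectrum.algebraMap_mem ℂ hmem
  -- s⁻¹ − 1 is the preimage of s under t ↦ (1+t)⁻¹; it is nonnegative because s ≤ 1.
  have ht : ((s⁻¹ - 1 : ℝ) : ℂ) ∈
      spectrumOf (formOperator {p : H × K | WithLp.toLp 2 p ∈ G}) := by
    intro h
    refine notMem_spectrum_graphResolvent G ?_ h ?_
    · have := (one_le_inv₀ hspos).2 hs1
      linarith
    · simpa using hmem'
  refine (iInf₂_le (f := fun (t : ℝ) (_ : (t : ℂ) ∈ spectrumOf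
    (formOperator {p : H × K | WithLp.toLp 2 p ∈ G})) => (t : EReal)) _ ht).trans ?_
  rw [EReal.coe_le_coe_iff, sub_le_iff_le_add, inv_le_iff_one_le_mul₀ hspos]
  linarith

end Spectral

/-! ### The magnetic gradient has a closed graph. -/

section Closedness

theorem exists_pairing {X : Type*} [MeasurableSpace X] {μ : Measure X} {g : X → ℂ}
    (hg : MemLp g 2 μ) :
    ∃ ℓ : Lp ℂ 2 μ →L[ℂ] ℂ, ∀ u : Lp ℂ 2 μ, ℓ u = ∫ x, u x * g x ∂μ := by
  have hg' : MemLp (fun x => (starRingEnd ℂ) (g x)) 2 μ := hg.star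
  refine ⟨innerSL ℂ hg'.toLp, fun u => ?_⟩
  rw [innerSL_apply_apply, L2.inner_def]
  refine integral_congr_ae ?_
  filter_upwards [hg'.coeFn_toLp] with x hx
  rw [hx]
  simp

theorem Lp.integrable_mul {X : Type*} [MeasurableSpace X] {μ : Measure X} {g : X → ℂ}
    (hg : MemLp g 2 μ) (u : Lp ℂ 2 μ) : Integrable (fun x => u x * g x) μ :=
  (Lp.memLp u).integrable_mul hg

variable (A : Space →ₗ[ℝ] Space) (Ω : Set Space)

theorem continuous_potential (j : Fin 3) : Continuous fun x : Space => A x j :=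
  (PiLp.continuous_apply 2 _ j).comp A.continuous_of_finiteDimensional

/-- For a fixed test function the weak equation only involves L² pairings: the unbounded potential
can be moved onto φ, whose support is compact. The graph is therefore an intersection of kernels of
continuous functionals. -/
theorem exists_magneticGradient_functional (j : Fin 3) {φ : Space → ℂ} (hφ : ContDiff ℝ ∞ φ)
    (hc : HasCompactSupport φ) :
    ∃ Λ : WithLp 2 (L2 Ω × PiLp 2 (fun _ : Fin 3 => L2 Ω)) →L[ℂ] ℂ, ∀ p,
      (∫ x in Ω, (p.fst : Space → ℂ) x * fderiv ℝ φ x (stdVec j) =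
        -∫ x in Ω, (Complex.I * ((p.snd j : Space → ℂ) x +
          ((A x j : ℝ) : ℂ) * (p.fst : Space → ℂ) x)) * φ x) ↔ Λ p = 0 := by
  have hdφ : Continuous fun x => fderiv ℝ φ x (stdVec j) :=
    (hφ.continuous_fderiv (by simp)).clm_apply continuous_const
  have hA : Continuous fun x : Space => ((A x j : ℝ) : ℂ) :=
    Complex.continuous_ofReal.comp (continuous_potential A j)
  have h1 : MemLp (fun x => fderiv ℝ φ x (stdVec j)) 2 (volume.restrict Ω) :=
    hdφ.memLp_of_hasCompactSupport (hc.fderiv_apply ℝ _)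
  have h2 : MemLp φ 2 (volume.restrict Ω) := hφ.continuous.memLp_of_hasCompactSupport hc
  have h3 : MemLp (fun x => ((A x j : ℝ) : ℂ) * φ x) 2 (volume.restrict Ω) :=
    (hA.mul hφ.continuous).memLp_of_hasCompactSupport hc.mul_left
  obtain ⟨ℓ₁, hℓ₁⟩ := exists_pairing h1
  obtain ⟨ℓ₂, hℓ₂⟩ := exists_pairing h2
  obtain ⟨ℓ₃, hℓ₃⟩ := exists_pairing h3
  let F := WithLp.fstL 2 ℂ (L2 Ω) (PiLp 2 (fun _ : Fin 3 => L2 Ω))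
  let S := (PiLp.proj 2 (𝕜 := ℂ) (fun _ : Fin 3 => L2 Ω) j).comp
    (WithLp.sndL 2 ℂ (L2 Ω) (PiLp 2 (fun _ : Fin 3 => L2 Ω)))
  refine ⟨ℓ₁.comp F + Complex.I • (ℓ₂.comp S + ℓ₃.comp F), fun p => ?_⟩
  have e : ∫ x in Ω, (Complex.I * ((p.snd j : Space → ℂ) x +
          ((A x j : ℝ) : ℂ) * (p.fst : Space → ℂ) x)) * φ x
      = Complex.I * (ℓ₂ (p.snd j) + ℓ₃ p.fst) := by
    rw [hℓ₂, hℓ₃, ← integral_add (Lp.integrable_mul h2 _) (Lp.integrable_mul h3 _),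
      ← integral_const_mul]
    congr 1
    ext x
    ring
  have e' : (ℓ₁.comp F + Complex.I • (ℓ₂.comp S + ℓ₃.comp F)) p =
      ℓ₁ p.fst + Complex.I * (ℓ₂ (p.snd j) + ℓ₃ p.fst) := by
    simp only [add_apply, smul_apply, ContinuousLinearMap.comp_apply, smul_eq_mul, F, S,
      WithLp.fstL_apply, WithLp.sndL_apply, PiLp.proj_apply]
  rw [e, e', ← hℓ₁, eq_neg_iff_add_eq_zero]

/-- The magnetic gradient as a subspace of the Hilbert sum. -/
def magneticGraph : Submodule ℂ (WithLp 2 (L2 Ω × PiLp 2 (fun _ : Fin 3 => L2 Ω))) where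
  carrier := {p | (p.fst, p.snd) ∈ magneticGradient A Ω}
  zero_mem' j φ hφ hc hs := by
    obtain ⟨Λ, hΛ⟩ := exists_magneticGradient_functional A Ω j hφ hc
    exact (hΛ 0).2 (map_zero Λ)
  add_mem' {p q} hp hq j φ hφ hc hs := by
    obtain ⟨Λ, hΛ⟩ := exists_magneticGradient_functional A Ω j hφ hc
    have h1 := (hΛ p).1 (hp j φ hφ hc hs)
    have h2 := (hΛ q).1 (hq j φ hφ hc hs)
    exact (hΛ (p + q)).2 (by rw [map_add, h1, h2, add_zero])
  smul_mem' c p hp j φ hφ hc hs := by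
    obtain ⟨Λ, hΛ⟩ := exists_magneticGradient_functional A Ω j hφ hc
    have h1 := (hΛ p).1 (hp j φ hφ hc hs)
    exact (hΛ (c • p)).2 (by rw [map_smul, h1, smul_zero])

theorem isClosed_magneticGraph :
    IsClosed (magneticGraph A Ω : Set (WithLp 2 (L2 Ω × PiLp 2 (fun _ : Fin 3 => L2 Ω)))) := by
  have : (magneticGraph A Ω : Set (WithLp 2 (L2 Ω × PiLp 2 (fun _ : Fin 3 => L2 Ω)))) =
      ⋂ (j : Fin 3) (φ : Space → ℂ) (_ : ContDiff ℝ ∞ φ) (_ : HasCompactSupport φ)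
        (_ : tsupport φ ⊆ Ω), {p | ∫ x in Ω, (p.fst : Space → ℂ) x * fderiv ℝ φ x (stdVec j) =
        -∫ x in Ω, (Complex.I * ((p.snd j : Space → ℂ) x +
          ((A x j : ℝ) : ℂ) * (p.fst : Space → ℂ) x)) * φ x} := by
    ext p
    simp only [Set.mem_iInter]
    rfl
  rw [this]
  refine isClosed_iInter fun j => isClosed_iInter fun φ => isClosed_iInter fun hφ =>
    isClosed_iInter fun hc => isClosed_iInter fun _ => ?_
  obtain ⟨Λ, hΛ⟩ := exists_magneticGradient_functional A Ω j hφ hc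
  simp only [hΛ]
  exact isClosed_singleton.preimage Λ.continuous

/-- The variational upper bound for the ground state energy. -/
theorem groundEnergy_le {u : L2 Ω} {w : PiLp 2 (fun _ : Fin 3 => L2 Ω)} (hu : u ≠ 0)
    (huw : (u, w) ∈ magneticGradient A Ω) {c : ℝ} (hc : ‖w‖ ^ 2 ≤ c * ‖u‖ ^ 2) :
    groundEnergy A Ω ≤ (c : EReal) := by
  have : CompleteSpace (magneticGraph A Ω) :=
    (isClosed_magneticGraph A Ω).completeSpace_coe
  exact bottomOfSpectrum_le (magneticGraph A Ω) hu huw hc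

end Closedness

/-! ### Geometry of the wedge, and integration over it in terms of r dr. -/

section Measures

open scoped ENNReal

/-- The open wedge with slope `T`. -/
def openWedge (T : ℝ) : Set Space := {x | |x 1| < x 0 * T}

theorem continuous_coord (j : Fin 3) : Continuous fun x : Space => x j :=
  PiLp.continuous_apply 2 _ j

theorem isOpen_openWedge (T : ℝ) : IsOpen (openWedge T) :=
  isOpen_lt (continuous_coord 1).abs ((continuous_coord 0).mul continuous_const)

theorem measurableSet_openWedge (T : ℝ) : MeasurableSet (openWedge T) :=
  (isOpen_openWedge T).measurableSet

theorem tan_half_pos {α : ℝ} (h0 : 0 < α) (h1 : α < Real.pi) : 0 < Real.tan (α / 2) :=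
  Real.tan_pos_of_pos_of_lt_pi_div_two (by linarith) (by linarith)

theorem interior_wedge {α : ℝ} (h0 : 0 < α) (h1 : α < Real.pi) :
    interior (wedge α) = openWedge (Real.tan (α / 2)) := by
  have hT := tan_half_pos h0 h1
  have hw : wedge α = {x : Space | |x 1| ≤ x 0 * Real.tan (α / 2)} := by
    ext x
    simp only [wedge, Set.mem_ofPred_eq, h1, true_and, h1.ne, false_and, h1.not_gt, or_false]
  rw [hw]
  refine subset_antisymm (fun x hx => ?_)
    (interior_maximal (fun x hx => (le_of_lt (show |x 1| < _ from hx) :)) (isOpen_openWedge _))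
  -- An interior point can be pushed slightly towards decreasing `x 0` without leaving the wedge,
  -- which forces strict inequality at the point itself.
  have hc : Tendsto (fun t : ℝ => x - t • stdVec 0) (𝓝[>] 0) (𝓝 x) := by
    have : Continuous fun t : ℝ => x - t • stdVec 0 := by fun_prop
    simpa using (this.tendsto 0).mono_left nhdsWithin_le_nhds
  obtain ⟨t, ht, ht0⟩ :=
    ((hc.eventually (mem_interior_iff_mem_nhds.1 hx)).and self_mem_nhdsWithin).exists
  have ht' : |(x - t • stdVec 0 : Space) 1| ≤ (x - t • stdVec 0 : Space) 0 * Real.tan (α / 2) := ht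
  simp only [stdVec, PiLp.sub_apply, PiLp.smul_apply, PiLp.single_apply, smul_eq_mul,
    one_ne_zero, if_false, if_true, mul_zero, sub_zero, mul_one] at ht'
  have : 0 < t := ht0
  show |x 1| < x 0 * Real.tan (α / 2)
  nlinarith [mul_pos this hT]

/-- The point of `Space` with the given coordinates. -/
def ofCoords (p : ℝ × ℝ × ℝ) : Space := !₂[p.1, p.2.1, p.2.2]

theorem measurePreserving_ofCoords : MeasurePreserving ofCoords := by
  have h1 := (volume_preserving_piFinSuccAbove (fun _ : Fin 3 => ℝ) 0).symm
  have h2 := (volume_preserving_finTwoArrow ℝ).symm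
  have h3 := (MeasurePreserving.id (volume : Measure ℝ)).prod h2
  have h4 := (PiLp.volume_preserving_toLp (Fin 3)).comp (h1.comp h3)
  convert! h4 using 1
  ext p i
  fin_cases i <;> rfl

theorem measurableEmbedding_ofCoords : MeasurableEmbedding ofCoords := by
  refine (show Continuous ofCoords from ?_).measurableEmbedding ?_
  · unfold ofCoords
    refine (PiLp.continuous_toLp 2 _).comp (continuous_pi fun i => ?_)
    fin_cases i
    · exact continuous_fst
    · exact continuous_fst.comp continuous_snd
    · exact continuous_snd.comp continuous_snd
  · intro p q h
    refine Prod.ext ?_ (Prod.ext ?_ ?_)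
    · exact congrArg (fun x : Space => x 0) h
    · exact congrArg (fun x : Space => x 1) h
    · exact congrArg (fun x : Space => x 2) h

theorem lintegral_radialMeasure {f : ℝ → ℝ≥0∞} (hf : Measurable f) :
    ∫⁻ r, f r ∂radialMeasure = ∫⁻ r, ENNReal.ofReal r * f r := by
  rw [radialMeasure, lintegral_withDensity_eq_lintegral_mul _ (by fun_prop) hf]
  refine setLIntegral_eq_of_support_subset fun r hr => ?_
  by_contra h
  exact hr (by simp [ENNReal.ofReal_of_nonpos (not_lt.1 h)])

/-- The section at `x 0 = a` is the interval (−aT, aT). Its length 2Ta produces the radial weight;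
for a ≤ 0 it is empty, in agreement with `ENNReal.ofReal a = 0`. -/
theorem lintegral_openWedge {T : ℝ} (hT : 0 ≤ T) {f g : ℝ → ℝ≥0∞} (hf : Measurable f)
    (hg : Measurable g) :
    ∫⁻ x in openWedge T, f (x 0) * g (x 2) =
      ENNReal.ofReal (2 * T) * (∫⁻ r, f r ∂radialMeasure) * ∫⁻ z, g z := by
  have hm : Measurable fun x : Space => f (x 0) * g (x 2) :=
    (hf.comp (continuous_coord 0).measurable).mul (hg.comp (continuous_coord 2).measurable)
  rw [← lintegral_indicator (measurableSet_openWedge T),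
    ← measurePreserving_ofCoords.lintegral_comp (hm.indicator (measurableSet_openWedge T)),
    Measure.volume_eq_prod, lintegral_prod (fun p => (openWedge T).indicator
      (fun x => f (x 0) * g (x 2)) (ofCoords p)) ((hm.indicator (measurableSet_openWedge T)).comp
      measurePreserving_ofCoords.measurable).aemeasurable]
  have hin : ∀ a : ℝ, ∫⁻ q : ℝ × ℝ, (openWedge T).indicator (fun x => f (x 0) * g (x 2))
      (ofCoords (a, q)) = ENNReal.ofReal (2 * T) * (∫⁻ z, g z) * (ENNReal.ofReal a * f a) := by
    intro a
    have e : ∀ q : ℝ × ℝ, (openWedge T).indicator (fun x => f (x 0) * g (x 2)) (ofCoords (a, q)) =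
        (Set.Ioo (-(a * T)) (a * T)).indicator (fun _ => f a) q.1 * g q.2 := by
      intro q
      have hiff : ofCoords (a, q) ∈ openWedge T ↔ q.1 ∈ Set.Ioo (-(a * T)) (a * T) := by
        rw [Set.mem_Ioo, ← abs_lt]
        rfl
      by_cases h : q.1 ∈ Set.Ioo (-(a * T)) (a * T)
      · rw [Set.indicator_of_mem h, Set.indicator_of_mem (hiff.2 h)]
        rfl
      · rw [Set.indicator_of_notMem h, Set.indicator_of_notMem (mt hiff.1 h), zero_mul]
    simp_rw [e]
    rw [Measure.volume_eq_prod, lintegral_prod_mul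
      (measurable_const.indicator measurableSet_Ioo).aemeasurable hg.aemeasurable,
      lintegral_indicator_const measurableSet_Ioo, Real.volume_Ioo]
    have : a * T - -(a * T) = 2 * T * a := by ring
    rw [this, ENNReal.ofReal_mul (by positivity)]
    ring
  simp_rw [hin]
  rw [lintegral_const_mul _ (by fun_prop), lintegral_radialMeasure hf]
  ring

theorem lintegral_comp_mul_left {β : ℝ} (hβ : 0 < β) (f : ℝ → ℝ≥0∞) :
    ∫⁻ r, f (β * r) = ENNReal.ofReal β⁻¹ * ∫⁻ r, f r := by
  have h := (Homeomorph.mulLeft₀ β hβ.ne').measurableEmbedding.lintegral_map (μ := volume) f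
  simp only [Homeomorph.coe_mulLeft₀] at h
  rw [← h, Real.map_volume_mul_left hβ.ne', lintegral_smul_measure, abs_of_pos (inv_pos.2 hβ)]
  rfl

theorem lintegral_radialMeasure_comp_mul_left {β : ℝ} (hβ : 0 < β) {f : ℝ → ℝ≥0∞}
    (hf : Measurable f) :
    ∫⁻ r, f (β * r) ∂radialMeasure = ENNReal.ofReal (β⁻¹ ^ 2) * ∫⁻ r, f r ∂radialMeasure := by
  rw [lintegral_radialMeasure (f := fun r => f (β * r)) (by fun_prop), lintegral_radialMeasure hf]
  have e : ∀ r, ENNReal.ofReal r * f (β * r) =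
      ENNReal.ofReal β⁻¹ * (ENNReal.ofReal (β * r) * f (β * r)) := by
    intro r
    rw [← mul_assoc, ← ENNReal.ofReal_mul (by positivity), inv_mul_cancel_left₀ hβ.ne']
  simp_rw [e]
  rw [lintegral_const_mul _ (by fun_prop),
    lintegral_comp_mul_left hβ (fun s => ENNReal.ofReal s * f s), ← mul_assoc,
    ← ENNReal.ofReal_mul (by positivity), sq]

end Measures

/-! ### Weak derivatives on the wedge of functions of the first coordinate. -/

section WeakDerivatives

/-- `u` is integrable on `Ω` against continuous functions of compact support in `Ω`. -/
def IntegrableAgainstTest (Ω : Set Space) (u : Space → ℂ) : Prop :=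
  ∀ h : Space → ℂ, Continuous h → HasCompactSupport h →
    Integrable (fun x => u x * h x) (volume.restrict Ω)

theorem continuous_fderiv_apply_of_contDiff {E : Type*} [NormedAddCommGroup E] [NormedSpace ℝ E]
    {φ : E → ℂ} (hφ : ContDiff ℝ ∞ φ) (e : E) : Continuous fun x => fderiv ℝ φ x e :=
  (hφ.continuous_fderiv (by simp)).clm_apply continuous_const

theorem fderiv_apply_eq_zero_of_notMem_tsupport {E : Type*} [NormedAddCommGroup E]
    [NormedSpace ℝ E] {φ : E → ℂ} {x : E} (hx : x ∉ tsupport φ) (e : E) :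
    fderiv ℝ φ x e = 0 := by
  rw [Function.notMem_support.1 (fun h => hx (support_fderiv_subset ℝ h))]
  rfl

/-- The product rule comes from using gφ as a test function for u. -/
theorem HasWeakDeriv.mul_smooth {Ω : Set Space} {e : Space} {u w g : Space → ℂ}
    (h : HasWeakDeriv Ω e u w) (hg : ContDiff ℝ ∞ g) (hu : IntegrableAgainstTest Ω u)
    (hw : IntegrableAgainstTest Ω w) :
    HasWeakDeriv Ω e (fun x => g x * u x) (fun x => g x * w x + fderiv ℝ g x e * u x) := by
  intro φ hφ hc hs
  have hdφ := continuous_fderiv_apply_of_contDiff hφ e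
  have hdg := continuous_fderiv_apply_of_contDiff hg e
  have key := h (fun x => g x * φ x) (hg.mul hφ) hc.mul_left
    ((tsupport_mul_subset_right (f := g) (g := φ)).trans hs)
  have e1 : ∀ x, u x * fderiv ℝ (fun x => g x * φ x) x e =
      u x * (g x * fderiv ℝ φ x e) + u x * (fderiv ℝ g x e * φ x) := by
    intro x
    rw [fderiv_fun_mul (hg.differentiable (by simp) x) (hφ.differentiable (by simp) x)]
    simp only [add_apply, smul_apply, smul_eq_mul]
    ring
  simp_rw [e1] at key
  have i1 := hu (fun x => g x * fderiv ℝ φ x e) (hg.continuous.mul hdφ)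
    (hc.fderiv_apply ℝ e).mul_left
  have i2 := hu (fun x => fderiv ℝ g x e * φ x) (hdg.mul hφ.continuous) hc.mul_left
  have i3 := hw (fun x => g x * φ x) (hg.continuous.mul hφ.continuous) hc.mul_left
  rw [integral_add i1 i2] at key
  have e2 : ∫ x in Ω, (g x * w x + fderiv ℝ g x e * u x) * φ x =
      (∫ x in Ω, w x * (g x * φ x)) + ∫ x in Ω, u x * (fderiv ℝ g x e * φ x) := by
    rw [← integral_add i3 i2]
    congr 1
    ext x
    ring
  have e3 : ∫ x in Ω, g x * u x * fderiv ℝ φ x e = ∫ x in Ω, u x * (g x * fderiv ℝ φ x e) := by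
    congr 1
    ext x
    ring
  rw [e2, e3, neg_add, ← key]
  ring

theorem ofCoords_eq (a : ℝ) (q : ℝ × ℝ) :
    ofCoords (a, q) = ofCoords (0, q) + a • stdVec 0 := by
  ext i
  fin_cases i <;> simp [ofCoords, stdVec]

theorem integrable_of_integrableOn_openWedge {T : ℝ} {V : ℝ → ℂ}
    (hV : IntegrableAgainstTest (openWedge T) fun x => V (x 0)) {h : Space → ℂ}
    (hh : Continuous h) (hc : HasCompactSupport h) (hs : ∀ x ∉ openWedge T, h x = 0) :
    Integrable fun x : Space => V (x 0) * h x := by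
  rw [← integrableOn_iff_integrable_of_support_subset (s := openWedge T)]
  · exact hV h hh hc
  · intro x hx
    by_contra hx'
    exact hx (by simp [hs x hx'])

/-- A function of the first coordinate which is weakly differentiable on the half-line is weakly
differentiable on the wedge. -/
theorem hasWeakDeriv_comp_coord_zero {T : ℝ} (hT : 0 < T) {V V' : ℝ → ℂ}
    (h : HasWeakDeriv (Set.Ioi (0 : ℝ)) 1 V V')
    (hV : IntegrableAgainstTest (openWedge T) fun x => V (x 0))
    (hV' : IntegrableAgainstTest (openWedge T) fun x => V' (x 0)) :
    HasWeakDeriv (openWedge T) (stdVec 0) (fun x => V (x 0)) (fun x => V' (x 0)) := by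
  intro φ hφ hc hs
  have hdφ := continuous_fderiv_apply_of_contDiff hφ (stdVec 0)
  have z1 : ∀ x ∉ openWedge T, fderiv ℝ φ x (stdVec 0) = 0 := fun x hx =>
    fderiv_apply_eq_zero_of_notMem_tsupport (fun h => hx (hs h)) _
  have z2 : ∀ x ∉ openWedge T, φ x = 0 := fun x hx =>
    image_eq_zero_of_notMem_tsupport (fun h => hx (hs h))
  have i1 := integrable_of_integrableOn_openWedge hV hdφ (hc.fderiv_apply ℝ _) z1
  have i2 := integrable_of_integrableOn_openWedge hV' hφ.continuous hc z2
  rw [setIntegral_eq_integral_of_forall_compl_eq_zero fun x hx => by rw [z1 x hx, mul_zero],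
    setIntegral_eq_integral_of_forall_compl_eq_zero fun x hx => by rw [z2 x hx, mul_zero],
    ← measurePreserving_ofCoords.integral_comp measurableEmbedding_ofCoords,
    ← measurePreserving_ofCoords.integral_comp measurableEmbedding_ofCoords,
    Measure.volume_eq_prod,
    integral_prod_symm (fun p : ℝ × ℝ × ℝ => V (ofCoords p 0) * fderiv ℝ φ (ofCoords p) (stdVec 0))
      ((measurePreserving_ofCoords.integrable_comp_emb measurableEmbedding_ofCoords).2 i1),
    integral_prod_symm (fun p : ℝ × ℝ × ℝ => V' (ofCoords p 0) * φ (ofCoords p))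
      ((measurePreserving_ofCoords.integrable_comp_emb measurableEmbedding_ofCoords).2 i2),
    ← integral_neg]
  -- By Fubini it suffices to integrate by parts along each line parallel to the first axis.
  congr 1
  ext q
  set ℓ : ℝ → Space := fun a => ofCoords (0, q) + a • stdVec 0 with hℓ
  have hℓ0 : ∀ a, ofCoords (a, q) = ℓ a := fun a => ofCoords_eq a q
  have hcoord : ∀ a, (ℓ a) 0 = a := fun a => by rw [← hℓ0]; rfl
  have hℓs : ContDiff ℝ ∞ ℓ := by fun_prop
  have hsub : tsupport (φ ∘ ℓ) ⊆ ℓ ⁻¹' tsupport φ :=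
    tsupport_comp_subset_preimage φ hℓs.continuous
  -- On the open wedge |x₂| < x₁T forces x₁ > 0, so each slice of φ is an admissible test function
  -- on the half-line.
  have hpos : tsupport (φ ∘ ℓ) ⊆ Set.Ioi 0 := by
    intro a ha
    have : |(ℓ a) 1| < (ℓ a) 0 * T := hs (hsub ha)
    rw [hcoord] at this
    exact pos_of_mul_pos_left ((abs_nonneg _).trans_lt this) hT.le
  have hcpt : HasCompactSupport (φ ∘ ℓ) := by
    refine (hc.image (continuous_coord 0)).of_isClosed_subset (isClosed_tsupport _) fun a ha => ?_
    exact ⟨ℓ a, hsub ha, hcoord a⟩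
  have key := h (φ ∘ ℓ) (hφ.comp hℓs) hcpt hpos
  have hd : ∀ a, fderiv ℝ (φ ∘ ℓ) a 1 = fderiv ℝ φ (ℓ a) (stdVec 0) := by
    intro a
    have h1 : HasDerivAt ℓ (stdVec 0) a := by
      have := ((hasDerivAt_id a).smul_const (stdVec 0)).const_add (ofCoords (0, q))
      rwa [one_smul] at this
    have h2 := ((hφ.differentiable (by simp) (ℓ a)).hasFDerivAt).comp_hasDerivAt a h1
    rw [h2.hasFDerivAt.fderiv]
    simp
  rw [setIntegral_eq_integral_of_forall_compl_eq_zero fun a ha => by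
      rw [fderiv_apply_eq_zero_of_notMem_tsupport (fun h => ha (hpos h)), mul_zero],
    setIntegral_eq_integral_of_forall_compl_eq_zero fun a ha => by
      rw [image_eq_zero_of_notMem_tsupport (fun h => ha (hpos h)), mul_zero]] at key
  simp only [hℓ0, hcoord]
  simp only [hd] at key
  exact key

theorem hasWeakDeriv_comp_coord_of_ne {T : ℝ} {j : Fin 3} (hj : j ≠ 0) {V : ℝ → ℂ}
    (hV : IntegrableAgainstTest (openWedge T) fun x => V (x 0)) :
    HasWeakDeriv (openWedge T) (stdVec j) (fun x => V (x 0)) (fun _ => 0) := by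
  intro φ hφ hc hs
  have hdφ := continuous_fderiv_apply_of_contDiff hφ (stdVec j)
  have z1 : ∀ x ∉ openWedge T, fderiv ℝ φ x (stdVec j) = 0 := fun x hx =>
    fderiv_apply_eq_zero_of_notMem_tsupport (fun h => hx (hs h)) _
  have z2 : ∀ x ∉ openWedge T, φ x = 0 := fun x hx =>
    image_eq_zero_of_notMem_tsupport (fun h => hx (hs h))
  have i1 := integrable_of_integrableOn_openWedge hV hdφ (hc.fderiv_apply ℝ _) z1
  have i2 := integrable_of_integrableOn_openWedge hV hφ.continuous hc z2
  rw [setIntegral_eq_integral_of_forall_compl_eq_zero fun x hx => by rw [z1 x hx, mul_zero]]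
  have key := integral_bilinear_hasLineDerivAt_right_eq_neg_left_of_integrable
    (μ := (volume : Measure Space)) (B := ContinuousLinearMap.mul ℝ ℂ) (v := stdVec j)
    (f := fun x : Space => V (x 0)) (f' := fun _ => 0) (g := φ)
    (g' := fun x => fderiv ℝ φ x (stdVec j)) (by simp) i1 i2
    (fun x _ => by
      have : (fun t : ℝ => V ((x + t • stdVec j : Space) 0)) = fun _ => V (x 0) := by
        ext t
        simp [stdVec, hj.symm]
      show HasDerivAt (fun t : ℝ => V ((x + t • stdVec j : Space) 0)) 0 0
      rw [this]
      exact hasDerivAt_const _ _)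
    (fun x _ => ((hφ.differentiable (by simp) x).hasFDerivAt).hasLineDerivAt _)
  simpa using key

/-- Rescaling of weak derivatives on the half-line. -/
theorem HasWeakDeriv.comp_mul_left {β : ℝ} (hβ : 0 < β) {V V' : ℝ → ℂ}
    (h : HasWeakDeriv (Set.Ioi (0 : ℝ)) 1 V V') :
    HasWeakDeriv (Set.Ioi (0 : ℝ)) 1 (fun r => V (β * r)) (fun r => (β : ℂ) * V' (β * r)) := by
  intro φ hφ hc hs
  have hl : ContDiff ℝ ∞ fun s : ℝ => β⁻¹ * s := by fun_prop
  have hsub : tsupport (φ ∘ fun s : ℝ => β⁻¹ * s) ⊆ (fun s : ℝ => β⁻¹ * s) ⁻¹' tsupport φ :=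
    tsupport_comp_subset_preimage φ hl.continuous
  have key := h (φ ∘ fun s : ℝ => β⁻¹ * s) (hφ.comp hl)
    (hc.comp_homeomorph (Homeomorph.mulLeft₀ β⁻¹ (inv_pos.2 hβ).ne'))
    (fun s hs' => pos_of_mul_pos_right (hs (hsub hs')) (inv_pos.2 hβ).le)
  have hd : ∀ s, fderiv ℝ (φ ∘ fun s : ℝ => β⁻¹ * s) s 1 =
      (β : ℂ)⁻¹ * fderiv ℝ φ (β⁻¹ * s) 1 := by
    intro s
    have h1 : HasDerivAt (fun s : ℝ => β⁻¹ * s) β⁻¹ s := by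
      simpa using (hasDerivAt_id s).const_mul β⁻¹
    have h2 := ((hφ.differentiable (by simp) (β⁻¹ * s)).hasFDerivAt).comp_hasDerivAt s h1
    rw [h2.hasFDerivAt.fderiv]
    have : β⁻¹ = β⁻¹ • (1 : ℝ) := by simp
    rw [this, map_smul]
    simp
  simp only [hd, Function.comp_apply] at key
  have c1 := integral_comp_mul_left_Ioi
    (fun s => V s * ((β : ℂ)⁻¹ * fderiv ℝ φ (β⁻¹ * s) 1)) 0 hβ
  have c2 := integral_comp_mul_left_Ioi (fun s => V' s * φ (β⁻¹ * s)) 0 hβ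
  rw [mul_zero] at c1 c2
  simp only [inv_mul_cancel_left₀ hβ.ne'] at c1 c2
  rw [key, smul_neg, ← c2] at c1
  have hβ' : (β : ℂ) ≠ 0 := by exact_mod_cast hβ.ne'
  have e1 : ∀ r, V (β * r) * ((β : ℂ)⁻¹ * fderiv ℝ φ r 1) =
      (β : ℂ)⁻¹ * (V (β * r) * fderiv ℝ φ r 1) := fun r => by ring
  simp only [e1] at c1
  rw [integral_const_mul, inv_mul_eq_iff_eq_mul₀ hβ'] at c1
  rw [c1, mul_neg, ← integral_const_mul]
  simp only [mul_assoc]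

end WeakDerivatives

/-! ### Norms and derivatives of the trial function. -/

section TrialFunction

open scoped ENNReal

theorem ofReal_norm_sq_Lp {X : Type*} [MeasurableSpace X] {μ : Measure X} (f : Lp ℂ 2 μ) :
    ENNReal.ofReal (‖f‖ ^ 2) = ∫⁻ x, ENNReal.ofReal (‖f x‖ ^ 2) ∂μ := by
  have h := eLpNorm_nnreal_pow_eq_lintegral (μ := μ) (f := (f : X → ℂ)) (p := 2) two_ne_zero
  rw [ENNReal.ofReal_pow (norm_nonneg _), ofReal_norm, Lp.enorm_def]
  simp only [ENNReal.ofReal_pow (norm_nonneg _), ofReal_norm]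
  simpa using h

theorem ofReal_norm_sq_toLp {X : Type*} [MeasurableSpace X] {μ : Measure X} {f : X → ℂ}
    (hf : MemLp f 2 μ) :
    ENNReal.ofReal (‖hf.toLp‖ ^ 2) = ∫⁻ x, ENNReal.ofReal (‖f x‖ ^ 2) ∂μ := by
  rw [ofReal_norm_sq_Lp]
  refine lintegral_congr_ae ?_
  filter_upwards [hf.coeFn_toLp] with x hx
  rw [hx]

theorem memLp_two_of_lintegral_lt_top {X : Type*} [MeasurableSpace X] {μ : Measure X} {f : X → ℂ}
    (hf : Measurable f) (h : ∫⁻ x, ENNReal.ofReal (‖f x‖ ^ 2) ∂μ < ⊤) : MemLp f 2 μ := by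
  rw [memLp_two_iff_integrable_sq_norm hf.aestronglyMeasurable]
  refine ⟨(hf.norm.pow_const 2).aestronglyMeasurable, ?_⟩
  rwa [hasFiniteIntegral_iff_ofReal (ae_of_all _ fun x => by positivity)]

theorem lintegral_openWedge_ofReal {T : ℝ} (hT : 0 ≤ T) {F G : ℝ → ℝ} (hF : Measurable F)
    (hG : Measurable G) (hF0 : ∀ r, 0 ≤ F r) {M Y : ℝ} (hM : 0 ≤ M)
    (hFM : ∫⁻ r, ENNReal.ofReal (F r) ∂radialMeasure = ENNReal.ofReal M)
    (hGY : ∫⁻ z, ENNReal.ofReal (G z) = ENNReal.ofReal Y) :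
    ∫⁻ x in openWedge T, ENNReal.ofReal (F (x 0) * G (x 2)) = ENNReal.ofReal (2 * T * M * Y) := by
  simp only [ENNReal.ofReal_mul (hF0 _)]
  rw [lintegral_openWedge hT hF.ennreal_ofReal hG.ennreal_ofReal, hFM, hGY,
    ENNReal.ofReal_mul (q := Y) (by positivity), ENNReal.ofReal_mul (q := M) (by positivity)]

theorem lintegral_gaussian {κ : ℝ} (hκ : 0 < κ) :
    ∫⁻ z : ℝ, ENNReal.ofReal (Real.exp (-κ * z ^ 2)) = ENNReal.ofReal (√(Real.pi / κ)) := by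
  rw [← integral_gaussian, ofReal_integral_eq_lintegral_ofReal (integrable_exp_neg_mul_sq hκ)
    (ae_of_all _ fun z => by positivity)]

/-- Half of the Gaussian decay absorbs the factor z², so the kinetic energy in x₃ is controlled by κ
times another Gaussian, without computing a second moment. -/
theorem mul_sq_mul_exp_le {κ : ℝ} (hκ : 0 < κ) (z : ℝ) :
    (κ * z) ^ 2 * Real.exp (-κ * z ^ 2) ≤ 2 * κ * Real.exp (-(κ / 2) * z ^ 2) := by
  have h1 : κ * z ^ 2 ≤ 2 * Real.exp (κ / 2 * z ^ 2) := by
    nlinarith [Real.add_one_le_exp (κ / 2 * z ^ 2)]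
  have h2 : Real.exp (-(κ / 2) * z ^ 2) =
      Real.exp (κ / 2 * z ^ 2) * Real.exp (-κ * z ^ 2) := by
    rw [← Real.exp_add]
    congr 1
    ring
  rw [h2]
  nlinarith [mul_le_mul_of_nonneg_left
    (mul_le_mul_of_nonneg_right h1 (Real.exp_pos (-κ * z ^ 2)).le) hκ.le]

theorem norm_add_sq_le_of_pos {δ : ℝ} (hδ : 0 < δ) (a b : ℂ) :
    ‖a + b‖ ^ 2 ≤ (1 + δ) * ‖a‖ ^ 2 + (1 + δ⁻¹) * ‖b‖ ^ 2 := by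
  have h1 : ‖a + b‖ ^ 2 ≤ (‖a‖ + ‖b‖) ^ 2 :=
    pow_le_pow_left₀ (norm_nonneg _) (norm_add_le a b) 2
  have h2 : (1 + δ) * ‖a‖ ^ 2 + (1 + δ⁻¹) * ‖b‖ ^ 2 - (‖a‖ + ‖b‖) ^ 2 =
      δ⁻¹ * (δ * ‖a‖ - ‖b‖) ^ 2 := by
    field_simp
    ring
  have h3 : 0 ≤ δ⁻¹ * (δ * ‖a‖ - ‖b‖) ^ 2 := by positivity
  linarith

/-- The quadratic gauge function: the potential of the curl-free part of `A`, plus `s x₃`. -/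
def gaugePhase (A : Space →ₗ[ℝ] Space) (s : ℝ) (x : Space) : ℝ :=
  A (stdVec 0) 0 / 2 * (x 0 * x 0) + A (stdVec 1) 1 / 2 * (x 1 * x 1) +
    A (stdVec 2) 2 / 2 * (x 2 * x 2) + A (stdVec 0) 1 * (x 0 * x 1) +
    A (stdVec 2) 0 * (x 0 * x 2) + A (stdVec 2) 1 * (x 1 * x 2) + s * x 2

/-- The smooth factor of the trial function. -/
def trialFactor (A : Space →ₗ[ℝ] Space) (s κ : ℝ) (x : Space) : ℂ :=
  Complex.exp (((-(κ / 2) * (x 2 * x 2) : ℝ) : ℂ) + Complex.I * ((gaugePhase A s x : ℝ) : ℂ))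

theorem hasFDerivAt_coord (x : Space) (j : Fin 3) :
    HasFDerivAt (fun x : Space => x j) (EuclideanSpace.proj j : Space →L[ℝ] ℝ) x :=
  (EuclideanSpace.proj j : Space →L[ℝ] ℝ).hasFDerivAt

theorem contDiff_coord (j : Fin 3) : ContDiff ℝ ∞ fun x : Space => x j :=
  (EuclideanSpace.proj j : Space →L[ℝ] ℝ).contDiff

theorem contDiff_gaugePhase (A : Space →ₗ[ℝ] Space) (s : ℝ) : ContDiff ℝ ∞ (gaugePhase A s) := by
  have h0 := contDiff_coord 0
  have h1 := contDiff_coord 1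
  have h2 := contDiff_coord 2
  unfold gaugePhase
  fun_prop

theorem contDiff_trialFactor (A : Space →ₗ[ℝ] Space) (s κ : ℝ) :
    ContDiff ℝ ∞ (trialFactor A s κ) := by
  have h2 := contDiff_coord 2
  have hp := contDiff_gaugePhase A s
  have hq : ContDiff ℝ ∞ fun x : Space => -(κ / 2) * (x 2 * x 2) := by fun_prop
  have hp' := Complex.ofRealCLM.contDiff.comp hp
  have hq' := Complex.ofRealCLM.contDiff.comp hq
  exact (hq'.add (contDiff_const.mul hp')).cexp

theorem fderiv_trialFactor (A : Space →ₗ[ℝ] Space) (s κ : ℝ) (x e : Space) :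
    fderiv ℝ (trialFactor A s κ) x e = trialFactor A s κ x *
      (((-κ * x 2 * e 2 : ℝ) : ℂ) + Complex.I * (((
        (A (stdVec 0) 0 * x 0 + A (stdVec 0) 1 * x 1 + A (stdVec 2) 0 * x 2) * e 0 +
        (A (stdVec 0) 1 * x 0 + A (stdVec 1) 1 * x 1 + A (stdVec 2) 1 * x 2) * e 1 +
        (A (stdVec 2) 0 * x 0 + A (stdVec 2) 1 * x 1 + A (stdVec 2) 2 * x 2 + s) * e 2
          : ℝ)) : ℂ)) := by
  have h := hasFDerivAt_coord x
  have hp := (((((((h 0).mul (h 0)).const_mul (A (stdVec 0) 0 / 2)).add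
    (((h 1).mul (h 1)).const_mul (A (stdVec 1) 1 / 2))).add
    (((h 2).mul (h 2)).const_mul (A (stdVec 2) 2 / 2))).add
    (((h 0).mul (h 1)).const_mul (A (stdVec 0) 1))).add
    (((h 0).mul (h 2)).const_mul (A (stdVec 2) 0))).add
    (((h 1).mul (h 2)).const_mul (A (stdVec 2) 1)) |>.add ((h 2).const_mul s)
  have hq := ((h 2).mul (h 2)).const_mul (-(κ / 2))
  have hp' := (Complex.ofRealCLM.hasFDerivAt.comp x hp).const_mul Complex.I
  have hq' := Complex.ofRealCLM.hasFDerivAt.comp x hq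
  have key : HasFDerivAt (trialFactor A s κ) _ x := (hq'.add hp').cexp
  rw [key.fderiv]
  simp only [smul_apply, add_apply, ContinuousLinearMap.comp_apply, smul_eq_mul,
    PiLp.proj_apply, Complex.ofRealCLM_apply]
  refine congrArg₂ _ rfl ?_
  push_cast
  ring

theorem trialFactor_ne_zero (A : Space →ₗ[ℝ] Space) (s κ : ℝ) (x : Space) :
    trialFactor A s κ x ≠ 0 := Complex.exp_ne_zero _

theorem norm_trialFactor_sq (A : Space →ₗ[ℝ] Space) (s κ : ℝ) (x : Space) :
    ‖trialFactor A s κ x‖ ^ 2 = Real.exp (-κ * x 2 ^ 2) := by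
  rw [trialFactor, Complex.norm_exp, ← Real.exp_nat_mul]
  congr 1
  simp
  ring

theorem linear_apply_eq (A : Space →ₗ[ℝ] Space) (x : Space) (j : Fin 3) :
    A x j = A (stdVec 0) j * x 0 + A (stdVec 1) j * x 1 + A (stdVec 2) j * x 2 := by
  have hx : x = x 0 • stdVec 0 + x 1 • stdVec 1 + x 2 • stdVec 2 := by
    ext i
    fin_cases i <;> simp [stdVec]
  conv_lhs => rw [hx]
  simp only [map_add, map_smul, PiLp.add_apply, PiLp.smul_apply, smul_eq_mul]
  ring

/-- A profile V(x₁) is not square integrable over a wedge unbounded in x₃. Dividing by the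
nonvanishing factor g still gives local integrability, since g⁻¹h is continuous with compact
support. -/
theorem integrableAgainstTest_of_memLp {Ω : Set Space} {g u : Space → ℂ} (hg : Continuous g)
    (hg0 : ∀ x, g x ≠ 0) (hu : MemLp (fun x => g x * u x) 2 (volume.restrict Ω)) :
    IntegrableAgainstTest Ω u := by
  intro h hh hc
  have h1 : MemLp (fun x => (g x)⁻¹ * h x) 2 (volume.restrict Ω) :=
    ((hg.inv₀ hg0).mul hh).memLp_of_hasCompactSupport hc.mul_left
  refine (hu.integrable_mul h1).congr (ae_of_all _ fun x => ?_)
  have := hg0 x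
  simp only [Pi.mul_apply]
  field_simp

end TrialFunction

/-! ### Rayleigh quotient of the trial function on a wedge of slope T. -/

section EnergyBound

theorem lintegral_ofReal_linear_combination {X : Type*} [MeasurableSpace X] {μ : Measure X}
    {f g : X → ℝ} (hf : Measurable f) (hg : Measurable g) (hf0 : ∀ x, 0 ≤ f x)
    (hg0 : ∀ x, 0 ≤ g x) {a b p q : ℝ} (ha : 0 ≤ a) (hb : 0 ≤ b) (hp : 0 ≤ p) (hq : 0 ≤ q)
    (hfa : ∫⁻ x, ENNReal.ofReal (f x) ∂μ = ENNReal.ofReal a)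
    (hgb : ∫⁻ x, ENNReal.ofReal (g x) ∂μ = ENNReal.ofReal b) :
    ∫⁻ x, ENNReal.ofReal (p * f x + q * g x) ∂μ = ENNReal.ofReal (p * a + q * b) := by
  have e : ∀ x, ENNReal.ofReal (p * f x + q * g x) =
      ENNReal.ofReal p * ENNReal.ofReal (f x) + ENNReal.ofReal q * ENNReal.ofReal (g x) := by
    intro x
    rw [ENNReal.ofReal_add (mul_nonneg hp (hf0 x)) (mul_nonneg hq (hg0 x)),
      ENNReal.ofReal_mul hp, ENNReal.ofReal_mul hq]
  simp_rw [e]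
  rw [lintegral_add_left (by fun_prop), lintegral_const_mul _ (by fun_prop),
    lintegral_const_mul _ (by fun_prop), hfa, hgb,
    ENNReal.ofReal_add (mul_nonneg hp ha) (mul_nonneg hq hb), ENNReal.ofReal_mul hp,
    ENNReal.ofReal_mul hq]

theorem HasWeakDeriv.congr_ae {Ω : Set Space} {e : Space} {u u' w w' : Space → ℂ}
    (h : HasWeakDeriv Ω e u w) (hu : u' =ᵐ[volume.restrict Ω] u)
    (hw : w' =ᵐ[volume.restrict Ω] w) : HasWeakDeriv Ω e u' w' := by
  intro φ hφ hc hs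
  have h1 : ∫ x in Ω, u' x * fderiv ℝ φ x e = ∫ x in Ω, u x * fderiv ℝ φ x e := by
    refine integral_congr_ae ?_
    filter_upwards [hu] with x hx
    rw [hx]
  have h2 : ∫ x in Ω, w' x * φ x = ∫ x in Ω, w x * φ x := by
    refine integral_congr_ae ?_
    filter_upwards [hw] with x hx
    rw [hx]
  rw [h1, h2]
  exact h φ hφ hc hs

/-- E/N is the effective one-dimensional energy. The term in Q/N pays for the two potential entries
proportional to `x 1`, each at most T `x 0` in size; the term in κ pays for the Gaussian cutoff. -/
theorem groundEnergy_openWedge_le (A : Space →ₗ[ℝ] Space) {b σ T δ κ N E Q : ℝ}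
    (hc0 : |A (stdVec 1) 2 - A (stdVec 2) 1| ≤ 1) (hc2 : |A (stdVec 0) 1 - A (stdVec 1) 0| ≤ 1)
    (hb : A (stdVec 2) 0 - A (stdVec 0) 2 = b) (hT : 0 < T) (hδ : 0 < δ) (hκ : 0 < κ)
    (hN : 0 < N) (hE : 0 ≤ E) (hQ : 0 ≤ Q) {V V' : ℝ → ℂ} (hV : Measurable V)
    (hV' : Measurable V') (hVV' : HasWeakDeriv (Set.Ioi (0 : ℝ)) 1 V V')
    (hVN : ∫⁻ r, ENNReal.ofReal (‖V r‖ ^ 2) ∂radialMeasure = ENNReal.ofReal N)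
    (hVE : ∫⁻ r, ENNReal.ofReal (‖V' r‖ ^ 2 + (b * r - σ) ^ 2 * ‖V r‖ ^ 2) ∂radialMeasure =
      ENNReal.ofReal E)
    (hVQ : ∫⁻ r, ENNReal.ofReal (r ^ 2 * ‖V r‖ ^ 2) ∂radialMeasure = ENNReal.ofReal Q) :
    groundEnergy A (openWedge T) ≤
      (((1 + δ) * (E / N) + 2 * (1 + δ⁻¹) * T ^ 2 * (Q / N) + 4 * (1 + δ⁻¹) * κ : ℝ) : EReal) := by
  set Ω := openWedge T with hΩ
  set g := trialFactor A (-σ) κ with hg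
  have hgs : ContDiff ℝ ∞ g := contDiff_trialFactor A (-σ) κ
  have hgc : Continuous g := hgs.continuous
  have hgm : Measurable g := hgc.measurable
  have hx : ∀ j : Fin 3, Measurable fun x : Space => x j := fun j => (continuous_coord j).measurable
  have hVx : Measurable fun x : Space => V (x 0) := hV.comp (hx 0)
  have hVx' : Measurable fun x : Space => V' (x 0) := hV'.comp (hx 0)
  set Y := √(Real.pi / κ) with hY
  set Y' := √(Real.pi / (κ / 2)) with hY'
  have hYpos : 0 < Y := Real.sqrt_pos.2 (by positivity)
  have hY'0 : 0 ≤ Y' := Real.sqrt_nonneg _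
  -- The exact ratio is √2; the cruder factor 2 turns 2qκ into the constant 4qκ of the bound.
  have hYY' : Y' ≤ 2 * Y := by
    rw [hY, hY']
    refine Real.sqrt_le_iff.2 ⟨by positivity, ?_⟩
    rw [mul_pow, Real.sq_sqrt (by positivity)]
    have : Real.pi / (κ / 2) = 2 * (Real.pi / κ) := by field_simp
    rw [this]
    have : 0 ≤ Real.pi / κ := by positivity
    linarith
  have hGY := lintegral_gaussian hκ
  have hGY' := lintegral_gaussian (half_pos hκ)
  -- the trial function
  have hu2 : ∫⁻ x in Ω, ENNReal.ofReal (‖g x * V (x 0)‖ ^ 2) =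
      ENNReal.ofReal (2 * T * N * Y) := by
    rw [← lintegral_openWedge_ofReal hT.le (hV.norm.pow_const 2)
      (G := fun z => Real.exp (-κ * z ^ 2)) (by fun_prop) (fun r => by positivity) hN.le hVN hGY]
    congr 1
    ext x
    rw [norm_mul, mul_pow, norm_trialFactor_sq, mul_comm]
  have hu : MemLp (fun x => g x * V (x 0)) 2 (volume.restrict Ω) :=
    memLp_two_of_lintegral_lt_top (hgm.mul hVx) (hu2 ▸ ENNReal.ofReal_lt_top)
  have hFE0 : ∀ r, 0 ≤ ‖V' r‖ ^ 2 + (b * r - σ) ^ 2 * ‖V r‖ ^ 2 := fun r => by positivity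
  have hFEm : Measurable fun r => ‖V' r‖ ^ 2 + (b * r - σ) ^ 2 * ‖V r‖ ^ 2 := by fun_prop
  have hu' : MemLp (fun x => g x * V' (x 0)) 2 (volume.restrict Ω) := by
    refine memLp_two_of_lintegral_lt_top (hgm.mul hVx') ?_
    refine lt_of_le_of_lt (lintegral_mono fun x => ENNReal.ofReal_le_ofReal ?_)
      (lt_of_eq_of_lt (lintegral_openWedge_ofReal hT.le hFEm
        (G := fun z => Real.exp (-κ * z ^ 2)) (by fun_prop) hFE0 hE hVE hGY) ENNReal.ofReal_lt_top)
    rw [norm_mul, mul_pow, norm_trialFactor_sq, mul_comm]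
    refine mul_le_mul_of_nonneg_right ?_ (Real.exp_pos _).le
    have : 0 ≤ (b * x 0 - σ) ^ 2 * ‖V (x 0)‖ ^ 2 := by positivity
    linarith
  have hg0 : ∀ x, g x ≠ 0 := trialFactor_ne_zero A (-σ) κ
  have hVt := integrableAgainstTest_of_memLp hgc hg0 hu
  have hVt' := integrableAgainstTest_of_memLp hgc hg0 hu'
  -- its magnetic gradient
  let w : Fin 3 → Space → ℂ := ![
    fun x => g x * (-Complex.I * V' (x 0) +
      (((A (stdVec 0) 1 - A (stdVec 1) 0) * x 1 : ℝ) : ℂ) * V (x 0)),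
    fun _ => 0,
    fun x => g x * (((b * x 0 - σ : ℝ) : ℂ) * V (x 0) +
      (((-(A (stdVec 1) 2 - A (stdVec 2) 1) * x 1 : ℝ) : ℂ) +
        ((κ * x 2 : ℝ) : ℂ) * Complex.I) * V (x 0))]
  -- Differentiating the phase cancels A up to the entries of its curl; the second component
  -- vanishes altogether. The extra imaginary term in the third comes from the Gaussian.
  have hD : ∀ j : Fin 3, HasWeakDeriv Ω (stdVec j) (fun x => g x * V (x 0))
      (fun x => Complex.I * (w j x + ((A x j : ℝ) : ℂ) * (g x * V (x 0)))) := by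
    have h0 := (hasWeakDeriv_comp_coord_zero hT hVV' hVt hVt').mul_smooth hgs hVt hVt'
    have hz : IntegrableAgainstTest Ω fun _ => 0 := fun h _ _ => by simp
    have h1 := (hasWeakDeriv_comp_coord_of_ne (j := 1) (by decide) hVt).mul_smooth hgs hVt hz
    have h2 := (hasWeakDeriv_comp_coord_of_ne (j := 2) (by decide) hVt).mul_smooth hgs hVt hz
    intro j
    fin_cases j
    · refine h0.congr_ae (ae_of_all _ fun x => rfl) (ae_of_all _ fun x => ?_)
      simp only [hg, fderiv_trialFactor, linear_apply_eq A x]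
      simp only [w, stdVec, PiLp.single_apply, hg]
      simp
      linear_combination (-trialFactor A (-σ) κ x * V' (x 0)) * Complex.I_sq
    · refine h1.congr_ae (ae_of_all _ fun x => rfl) (ae_of_all _ fun x => ?_)
      simp only [hg, fderiv_trialFactor, linear_apply_eq A x]
      simp only [w, stdVec, PiLp.single_apply, hg]
      simp
      ring
    · refine h2.congr_ae (ae_of_all _ fun x => rfl) (ae_of_all _ fun x => ?_)
      simp only [hg, fderiv_trialFactor, linear_apply_eq A x]
      simp only [w, ← hb, stdVec, PiLp.single_apply, hg]
      simp
      linear_combination (trialFactor A (-σ) κ x * V (x 0) * κ * x 2) * Complex.I_sq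
  have hwm : ∀ j, Measurable (w j) := by
    have c1 : ∀ c : ℝ, Measurable fun x : Space => ((c * x 1 : ℝ) : ℂ) := fun c =>
      Complex.measurable_ofReal.comp ((hx 1).const_mul c)
    have c2 : Measurable fun x : Space => ((κ * x 2 : ℝ) : ℂ) :=
      Complex.measurable_ofReal.comp ((hx 2).const_mul κ)
    have c3 : Measurable fun x : Space => ((b * x 0 - σ : ℝ) : ℂ) :=
      Complex.measurable_ofReal.comp (((hx 0).const_mul b).sub_const σ)
    intro j
    fin_cases j
    · exact hgm.mul ((hVx'.const_mul _).add ((c1 _).mul hVx))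
    · exact measurable_const
    · exact hgm.mul ((c3.mul hVx).add (((c1 _).add (c2.mul_const _)).mul hVx))
  set p := 1 + δ with hp
  set q := 1 + δ⁻¹ with hq
  have hp0 : 0 ≤ p := by positivity
  have hq0 : 0 ≤ q := by positivity
  have hx1 : ∀ x ∈ Ω, ∀ c : ℝ, |c| ≤ 1 → (c * x 1) ^ 2 ≤ T ^ 2 * x 0 ^ 2 := by
    intro x hxΩ c hc
    have h1 : |x 1| < x 0 * T := hxΩ
    have h2 : |c * x 1| ≤ |T * x 0| := by
      rw [abs_mul]
      calc |c| * |x 1| ≤ 1 * |x 1| := mul_le_mul_of_nonneg_right hc (abs_nonneg _)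
        _ ≤ T * x 0 := by linarith
        _ ≤ _ := le_abs_self _
    calc (c * x 1) ^ 2 ≤ (T * x 0) ^ 2 := sq_le_sq.2 h2
      _ = _ := by ring
  have hbound : ∀ x ∈ Ω, ‖w 0 x‖ ^ 2 + ‖w 1 x‖ ^ 2 + ‖w 2 x‖ ^ 2 ≤
      1 * ((p * (‖V' (x 0)‖ ^ 2 + (b * x 0 - σ) ^ 2 * ‖V (x 0)‖ ^ 2) +
        (2 * q * T ^ 2) * (x 0 ^ 2 * ‖V (x 0)‖ ^ 2)) * Real.exp (-κ * x 2 ^ 2)) +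
      (2 * q * κ) * (‖V (x 0)‖ ^ 2 * Real.exp (-(κ / 2) * x 2 ^ 2)) := by
    intro x hxΩ
    have e0 : ‖w 0 x‖ ^ 2 ≤ Real.exp (-κ * x 2 ^ 2) *
        (p * ‖V' (x 0)‖ ^ 2 + q * (T ^ 2 * x 0 ^ 2 * ‖V (x 0)‖ ^ 2)) := by
      show ‖g x * (_ + _)‖ ^ 2 ≤ _
      rw [norm_mul, mul_pow, norm_trialFactor_sq]
      refine mul_le_mul_of_nonneg_left ((norm_add_sq_le_of_pos hδ _ _).trans ?_) (Real.exp_pos _).le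
      refine add_le_add (le_of_eq ?_) (mul_le_mul_of_nonneg_left ?_ hq0)
      · rw [norm_mul, norm_neg, Complex.norm_I, one_mul]
      · rw [norm_mul, mul_pow, Complex.norm_real, Real.norm_eq_abs, sq_abs]
        exact mul_le_mul_of_nonneg_right (hx1 x hxΩ _ hc2) (by positivity)
    have e2 : ‖w 2 x‖ ^ 2 ≤ Real.exp (-κ * x 2 ^ 2) *
        (p * ((b * x 0 - σ) ^ 2 * ‖V (x 0)‖ ^ 2) +
          q * ((T ^ 2 * x 0 ^ 2 + (κ * x 2) ^ 2) * ‖V (x 0)‖ ^ 2)) := by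
      show ‖g x * (_ + _)‖ ^ 2 ≤ _
      rw [norm_mul, mul_pow, norm_trialFactor_sq]
      refine mul_le_mul_of_nonneg_left ((norm_add_sq_le_of_pos hδ _ _).trans ?_) (Real.exp_pos _).le
      refine add_le_add (le_of_eq ?_) (mul_le_mul_of_nonneg_left ?_ hq0)
      · rw [norm_mul, mul_pow, Complex.norm_real, Real.norm_eq_abs, sq_abs]
      · rw [norm_mul, mul_pow]
        refine mul_le_mul_of_nonneg_right ?_ (by positivity)
        rw [Complex.sq_norm, Complex.normSq_add_mul_I]
        exact add_le_add (hx1 x hxΩ _ (by rwa [abs_neg])) le_rfl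
    have e1 : ‖w 1 x‖ ^ 2 = 0 := by
      show ‖(0 : ℂ)‖ ^ 2 = 0
      simp
    -- The only term of the third component not of the form F(`x 0`) exp(−κ `x 2`²) is traded for
    -- the wider Gaussian.
    have e3 := mul_le_mul_of_nonneg_left (mul_sq_mul_exp_le hκ (x 2))
      (show 0 ≤ q * ‖V (x 0)‖ ^ 2 by positivity)
    nlinarith
  have hI1 := lintegral_ofReal_linear_combination hFEm
    (g := fun r => r ^ 2 * ‖V r‖ ^ 2) (by fun_prop) hFE0 (fun r => by positivity) hE hQ hp0
    (show 0 ≤ 2 * q * T ^ 2 by positivity) hVE hVQ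
  have hM0 : 0 ≤ p * E + 2 * q * T ^ 2 * Q := by positivity
  have hF0 : ∀ r, 0 ≤ p * (‖V' r‖ ^ 2 + (b * r - σ) ^ 2 * ‖V r‖ ^ 2) +
      2 * q * T ^ 2 * (r ^ 2 * ‖V r‖ ^ 2) := fun r => by positivity
  have hFm : Measurable fun r => p * (‖V' r‖ ^ 2 + (b * r - σ) ^ 2 * ‖V r‖ ^ 2) +
      2 * q * T ^ 2 * (r ^ 2 * ‖V r‖ ^ 2) := by fun_prop
  have hI2 := lintegral_openWedge_ofReal hT.le hFm
    (G := fun z => Real.exp (-κ * z ^ 2)) (by fun_prop) hF0 hM0 hI1 hGY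
  have hI3 := lintegral_openWedge_ofReal hT.le (hV.norm.pow_const 2)
    (G := fun z => Real.exp (-(κ / 2) * z ^ 2)) (by fun_prop) (fun r => by positivity) hN.le hVN hGY'
  have m1 : ∀ {F G : ℝ → ℝ}, Measurable F → Measurable G →
      Measurable fun x : Space => F (x 0) * G (x 2) := fun hF hG =>
    (hF.comp (hx 0)).mul (hG.comp (hx 2))
  have hI4 := lintegral_ofReal_linear_combination
    (m1 hFm (show Measurable fun z : ℝ => Real.exp (-κ * z ^ 2) by fun_prop))
    (m1 (hV.norm.pow_const 2) (show Measurable fun z : ℝ => Real.exp (-(κ / 2) * z ^ 2) by fun_prop))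
    (fun x => mul_nonneg (hF0 _) (Real.exp_pos _).le) (fun x => by positivity)
    (show 0 ≤ 2 * T * (p * E + 2 * q * T ^ 2 * Q) * Y by positivity)
    (show 0 ≤ 2 * T * N * Y' by positivity) zero_le_one (show 0 ≤ 2 * q * κ by positivity) hI2 hI3
  have htotal : ∫⁻ x in Ω, ENNReal.ofReal (‖w 0 x‖ ^ 2 + ‖w 1 x‖ ^ 2 + ‖w 2 x‖ ^ 2) ≤
      ENNReal.ofReal (1 * (2 * T * (p * E + 2 * q * T ^ 2 * Q) * Y) +
        2 * q * κ * (2 * T * N * Y')) := by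
    rw [← hI4]
    refine setLIntegral_mono' (measurableSet_openWedge T) fun x hxΩ => ?_
    exact ENNReal.ofReal_le_ofReal (hbound x hxΩ)
  have hw : ∀ j, MemLp (w j) 2 (volume.restrict Ω) := by
    intro j
    refine memLp_two_of_lintegral_lt_top (hwm j) (lt_of_le_of_lt (lintegral_mono fun x =>
      ENNReal.ofReal_le_ofReal ?_) (htotal.trans_lt ENNReal.ofReal_lt_top))
    have h0 : 0 ≤ ‖w 0 x‖ ^ 2 := by positivity
    have h1 : 0 ≤ ‖w 1 x‖ ^ 2 := by positivity
    have h2 : 0 ≤ ‖w 2 x‖ ^ 2 := by positivity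
    fin_cases j
    · show ‖w 0 x‖ ^ 2 ≤ _
      linarith
    · show ‖w 1 x‖ ^ 2 ≤ _
      linarith
    · show ‖w 2 x‖ ^ 2 ≤ _
      linarith
  have hnu : ‖hu.toLp‖ ^ 2 = 2 * T * N * Y := by
    have := (ofReal_norm_sq_toLp hu).trans hu2
    rwa [ENNReal.ofReal_eq_ofReal_iff (by positivity) (by positivity)] at this
  have hu0 : hu.toLp ≠ 0 := by
    intro h
    rw [h, norm_zero, zero_pow two_ne_zero] at hnu
    have : 0 < 2 * T * N * Y := by positivity
    linarith
  refine groundEnergy_le A Ω (u := hu.toLp) (w := WithLp.toLp 2 fun j => (hw j).toLp) hu0 ?_ ?_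
  · intro j
    refine (hD j).congr_ae hu.coeFn_toLp ?_
    filter_upwards [hu.coeFn_toLp, (hw j).coeFn_toLp] with x h1 h2
    show Complex.I * (MemLp.toLp (w j) (hw j) x + _) = _
    rw [h1, h2]
  · have hnw : ENNReal.ofReal (‖WithLp.toLp 2 fun j => (hw j).toLp‖ ^ 2) =
        ∫⁻ x in Ω, ENNReal.ofReal (‖w 0 x‖ ^ 2 + ‖w 1 x‖ ^ 2 + ‖w 2 x‖ ^ 2) := by
      have m : ∀ j, Measurable fun x => ENNReal.ofReal (‖w j x‖ ^ 2) := fun j =>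
        ((hwm j).norm.pow_const 2).ennreal_ofReal
      have e : ∀ x, ENNReal.ofReal (‖w 0 x‖ ^ 2 + ‖w 1 x‖ ^ 2 + ‖w 2 x‖ ^ 2) =
          ENNReal.ofReal (‖w 0 x‖ ^ 2) + ENNReal.ofReal (‖w 1 x‖ ^ 2) +
            ENNReal.ofReal (‖w 2 x‖ ^ 2) := fun x => by
        rw [ENNReal.ofReal_add (by positivity) (by positivity),
          ENNReal.ofReal_add (by positivity) (by positivity)]
      simp_rw [e]
      rw [lintegral_add_left (f := fun x => ENNReal.ofReal (‖w 0 x‖ ^ 2) +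
          ENNReal.ofReal (‖w 1 x‖ ^ 2)) ((m 0).add (m 1)), lintegral_add_left (m 0),
        ← ofReal_norm_sq_toLp (hw 0), ← ofReal_norm_sq_toLp (hw 1), ← ofReal_norm_sq_toLp (hw 2),
        ← ENNReal.ofReal_add (by positivity) (by positivity),
        ← ENNReal.ofReal_add (by positivity) (by positivity), PiLp.norm_sq_eq_of_L2,
        Fin.sum_univ_three]
    rw [← hnw, ENNReal.ofReal_le_ofReal_iff (by positivity)] at htotal
    refine htotal.trans ?_
    rw [hnu]
    have e5 : (p * (E / N) + 2 * q * T ^ 2 * (Q / N) + 4 * q * κ) * (2 * T * N * Y) =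
        1 * (2 * T * (p * E + 2 * q * T ^ 2 * Q) * Y) + 2 * q * κ * (2 * T * N * (2 * Y)) := by
      field_simp
      ring
    rw [e5]
    gcongr

end EnergyBound

/-! ### Radial eigenfunctions as profiles, and the limit of small opening. -/

section Asymptotics

/-- Testing the weak eigenvalue equation with the eigenfunction itself shows that its energy is t
times its squared norm; in particular t ≥ 0. -/
theorem exists_radial_profile {τ t : ℝ} (h : IsEigenvalue (radialOperator τ) t) :
    ∃ (V V' : ℝ → ℂ) (N Q : ℝ), Measurable V ∧ Measurable V' ∧
      HasWeakDeriv (Set.Ioi (0 : ℝ)) 1 V V' ∧ 0 < N ∧ 0 ≤ Q ∧ 0 ≤ t ∧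
      ∫⁻ r, ENNReal.ofReal (‖V r‖ ^ 2) ∂radialMeasure = ENNReal.ofReal N ∧
      ∫⁻ r, ENNReal.ofReal (‖V' r‖ ^ 2 + (r - τ) ^ 2 * ‖V r‖ ^ 2) ∂radialMeasure =
        ENNReal.ofReal (t * N) ∧
      ∫⁻ r, ENNReal.ofReal (r ^ 2 * ‖V r‖ ^ 2) ∂radialMeasure = ENNReal.ofReal Q := by
  obtain ⟨u, hu, w, ⟨hw0, hw1⟩, hform⟩ := h
  have hmu : Measurable u := (Lp.stronglyMeasurable u).measurable
  have hmw : Measurable (w 0) := (Lp.stronglyMeasurable (w 0)).measurable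
  have hN : 0 < ‖u‖ ^ 2 := by positivity
  have hnorm : ‖w‖ ^ 2 = t * ‖u‖ ^ 2 := by
    have h1 := hform u w ⟨hw0, hw1⟩
    rw [inner_smul_right, inner_self_eq_norm_sq_to_K, inner_self_eq_norm_sq_to_K] at h1
    refine Complex.ofReal_injective ?_
    simpa using h1
  have ht : 0 ≤ t := by
    by_contra hneg
    nlinarith [sq_nonneg ‖w‖, mul_neg_of_neg_of_pos (not_le.1 hneg) hN]
  have hI1 : ∫⁻ r, ENNReal.ofReal ((r - τ) ^ 2 * ‖u r‖ ^ 2) ∂radialMeasure =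
      ENNReal.ofReal (‖w 1‖ ^ 2) := by
    rw [ofReal_norm_sq_Lp]
    refine lintegral_congr_ae ?_
    filter_upwards [hw1] with r hr
    rw [hr, norm_mul, mul_pow, Complex.norm_real, Real.norm_eq_abs, sq_abs]
  have hE : ∫⁻ r, ENNReal.ofReal (‖w 0 r‖ ^ 2 + (r - τ) ^ 2 * ‖u r‖ ^ 2) ∂radialMeasure =
      ENNReal.ofReal (t * ‖u‖ ^ 2) := by
    have := lintegral_ofReal_linear_combination (μ := radialMeasure)
      (f := fun r => ‖w 0 r‖ ^ 2) (g := fun r => (r - τ) ^ 2 * ‖u r‖ ^ 2)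
      (hmw.norm.pow_const 2) (by fun_prop) (fun r => by positivity) (fun r => by positivity)
      (sq_nonneg ‖w 0‖) (sq_nonneg ‖w 1‖) zero_le_one zero_le_one (ofReal_norm_sq_Lp (w 0)).symm hI1
    simp only [one_mul] at this
    rw [this, ← hnorm, PiLp.norm_sq_eq_of_L2, Fin.sum_univ_two]
  -- Uses r² ≤ 2(r − τ)² + 2τ², the difference of the two sides being (r − 2τ)².
  have hQ : ∫⁻ r, ENNReal.ofReal (r ^ 2 * ‖u r‖ ^ 2) ∂radialMeasure ≠ ⊤ := by
    have := lintegral_ofReal_linear_combination (μ := radialMeasure)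
      (f := fun r => (r - τ) ^ 2 * ‖u r‖ ^ 2) (g := fun r => ‖u r‖ ^ 2)
      (by fun_prop) (hmu.norm.pow_const 2) (fun r => by positivity) (fun r => by positivity)
      (sq_nonneg ‖w 1‖) hN.le zero_le_two (show 0 ≤ 2 * τ ^ 2 by positivity) hI1
      (ofReal_norm_sq_Lp u).symm
    refine ne_top_of_le_ne_top (this.trans_ne ENNReal.ofReal_ne_top)
      (lintegral_mono fun r => ENNReal.ofReal_le_ofReal ?_)
    nlinarith [mul_nonneg (sq_nonneg (r - 2 * τ)) (sq_nonneg ‖u r‖)]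
  exact ⟨u, w 0, ‖u‖ ^ 2, _, hmu, hmw, hw0, hN, ENNReal.toReal_nonneg, ht,
    (ofReal_norm_sq_Lp u).symm, hE, (ENNReal.ofReal_toReal hQ).symm⟩

/-- The profile of a radial eigenfunction, rescaled to magnetic field strength `b`. -/
theorem exists_scaled_profile {τ t b : ℝ} (hb : 0 < b) (h : IsEigenvalue (radialOperator τ) t) :
    ∃ (V V' : ℝ → ℂ) (σ N Q : ℝ), Measurable V ∧ Measurable V' ∧
      HasWeakDeriv (Set.Ioi (0 : ℝ)) 1 V V' ∧ 0 < N ∧ 0 ≤ Q ∧ 0 ≤ t ∧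
      ∫⁻ r, ENNReal.ofReal (‖V r‖ ^ 2) ∂radialMeasure = ENNReal.ofReal N ∧
      ∫⁻ r, ENNReal.ofReal (‖V' r‖ ^ 2 + (b * r - σ) ^ 2 * ‖V r‖ ^ 2) ∂radialMeasure =
        ENNReal.ofReal (b * t * N) ∧
      ∫⁻ r, ENNReal.ofReal (r ^ 2 * ‖V r‖ ^ 2) ∂radialMeasure = ENNReal.ofReal Q := by
  obtain ⟨V, V', N, Q, hV, hV', hVV', hN, hQ, ht, hVN, hVE, hVQ⟩ := exists_radial_profile h
  have hβ : 0 < √b := Real.sqrt_pos.2 hb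
  have hβb : √b ^ 2 = b := Real.sq_sqrt hb.le
  set β := √b
  have hmul : ∀ {c : ℝ} {F : ℝ → ℝ}, 0 ≤ c → Measurable F →
      ∫⁻ r, ENNReal.ofReal (c * F (β * r)) ∂radialMeasure = ENNReal.ofReal (c * β⁻¹ ^ 2) *
        ∫⁻ r, ENNReal.ofReal (F r) ∂radialMeasure := by
    intro c F hc hF
    simp only [ENNReal.ofReal_mul hc]
    rw [lintegral_const_mul _ (by fun_prop), lintegral_radialMeasure_comp_mul_left hβ
      (f := fun r => ENNReal.ofReal (F r)) (by fun_prop), mul_assoc]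
  -- With β = √b and σ = βτ one has br − σ = β(βr − τ), so both terms of the energy density gain the
  -- same factor β² = b, while the measure r dr contributes β⁻².
  refine ⟨fun r => V (β * r), fun r => (β : ℂ) * V' (β * r), β * τ, β⁻¹ ^ 2 * N,
    β⁻¹ ^ 2 * β⁻¹ ^ 2 * Q, by fun_prop, by fun_prop, hVV'.comp_mul_left hβ, by positivity,
    by positivity, ht, ?_, ?_, ?_⟩
  · have := hmul (F := fun r => ‖V r‖ ^ 2) zero_le_one (by fun_prop)
    simp only [one_mul] at this
    rw [this, hVN, ← ENNReal.ofReal_mul (by positivity)]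
  · have := hmul (c := β ^ 2) (F := fun r => ‖V' r‖ ^ 2 + (r - τ) ^ 2 * ‖V r‖ ^ 2)
      (by positivity) (by fun_prop)
    rw [hVE, ← ENNReal.ofReal_mul (by positivity)] at this
    rw [show b * t * (β⁻¹ ^ 2 * N) = β ^ 2 * β⁻¹ ^ 2 * (t * N) by rw [hβb]; ring, ← this]
    congr 1
    ext r
    congr 1
    rw [norm_mul, Complex.norm_real, Real.norm_of_nonneg hβ.le, ← hβb]
    ring
  · have := hmul (c := β⁻¹ ^ 2) (F := fun r => r ^ 2 * ‖V r‖ ^ 2) (by positivity) (by fun_prop)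
    rw [hVQ, ← ENNReal.ofReal_mul (by positivity)] at this
    rw [← this]
    congr 1
    ext r
    congr 1
    field_simp

theorem abs_apply_le_norm (x : Space) (j : Fin 3) : |x j| ≤ ‖x‖ := by
  simpa using PiLp.norm_apply_le x j

theorem tendsto_tan_half : Tendsto (fun α : ℝ => Real.tan (α / 2)) (𝓝[>] 0) (𝓝 0) := by
  have h : ContinuousAt (fun α : ℝ => Real.tan (α / 2)) 0 := by
    refine ContinuousAt.comp (f := fun α : ℝ => α / 2) (g := Real.tan) ?_ (by fun_prop)
    exact Real.continuousAt_tan.2 (by simp)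
  have := h.tendsto
  simp only [zero_div, Real.tan_zero] at this
  exact this.mono_left nhdsWithin_le_nhds

theorem limsup_groundEnergy_le (B : Space) (hB : ‖B‖ = 1) (hB2 : 0 < B 1)
    (A : Space →ₗ[ℝ] Space) (hA : curl A = B) {τ t : ℝ}
    (h : IsEigenvalue (radialOperator τ) t) :
    limsup (fun α : ℝ => groundEnergy A (interior (wedge α))) (𝓝[>] 0) ≤
      ((B 1 * t : ℝ) : EReal) := by
  obtain ⟨V, V', σ, N, Q, hV, hV', hVV', hN, hQ, ht, hVN, hVE, hVQ⟩ :=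
    exists_scaled_profile hB2 h
  have hc0 : |A (stdVec 1) 2 - A (stdVec 2) 1| ≤ 1 := by
    have := abs_apply_le_norm B 0
    rwa [hB, ← hA] at this
  have hc2 : |A (stdVec 0) 1 - A (stdVec 1) 0| ≤ 1 := by
    have := abs_apply_le_norm B 2
    rwa [hB, ← hA] at this
  have hb : A (stdVec 2) 0 - A (stdVec 0) 2 = B 1 := by
    rw [← hA]
    rfl
  have hE : 0 ≤ B 1 * t * N := by positivity
  rw [← EReal.le_of_forall_lt_iff_le]
  intro z hz
  rw [EReal.coe_lt_coe_iff] at hz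
  obtain ⟨ε, hε, rfl⟩ : ∃ ε > 0, z = B 1 * t + ε := ⟨z - B 1 * t, by linarith, by ring⟩
  -- Each of the three error terms gets ε/3: δ is fixed first, then κ depending on δ, and finally α
  -- is taken small. The +1 covers t = 0.
  set δ := ε / (3 * (B 1 * t + 1)) with hδ
  have hbt : 0 ≤ B 1 * t := by positivity
  have hδpos : 0 < δ := by positivity
  have hδε : δ * (B 1 * t) ≤ ε / 3 := by
    have : δ * (B 1 * t + 1) = ε / 3 := by
      rw [hδ]
      field_simp
    nlinarith
  set κ := ε / (3 * (4 * (1 + δ⁻¹))) with hκ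
  have hκpos : 0 < κ := by positivity
  have hκε : 4 * (1 + δ⁻¹) * κ = ε / 3 := by
    have : 1 + δ⁻¹ ≠ 0 := by positivity
    rw [hκ]
    field_simp
  have hTlim : Tendsto (fun α : ℝ => 2 * (1 + δ⁻¹) * Real.tan (α / 2) ^ 2 * (Q / N))
      (𝓝[>] 0) (𝓝 0) := by
    simpa using ((tendsto_tan_half.pow 2).const_mul (2 * (1 + δ⁻¹))).mul_const (Q / N)
  refine limsup_le_of_le (by isBoundedDefault) ?_
  filter_upwards [hTlim.eventually (ge_mem_nhds (show 0 < ε / 3 by positivity)),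
    Ioo_mem_nhdsGT Real.pi_pos] with α hα hα'
  rw [interior_wedge hα'.1 hα'.2]
  refine (groundEnergy_openWedge_le A hc0 hc2 hb (tan_half_pos hα'.1 hα'.2) hδpos hκpos hN hE hQ
    hV hV' hVV' hVN hVE hVQ).trans ?_
  rw [EReal.coe_le_coe_iff, mul_div_cancel_right₀ _ hN.ne']
  linarith

end Asymptotics

end MagneticWedge
end

theorem corollary5p3 (B : MagneticWedge.Space) (hB : ‖B‖ = 1) (hB2 : 0 < B 1)
    (A : MagneticWedge.Space →ₗ[ℝ] MagneticWedge.Space) (hA : MagneticWedge.curl A = B) :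
    Filter.limsup
        (fun α : ℝ => MagneticWedge.groundEnergy A (interior (MagneticWedge.wedge α)))
        (nhdsWithin 0 (Set.Ioi 0)) ≤
      ((B 1 : ℝ) : EReal) * MagneticWedge.Xi0 := by
  have hpos : (0 : EReal) < ((B 1 : ℝ) : EReal) := EReal.coe_pos.2 hB2
  rw [← EReal.div_le_iff_le_mul hpos (EReal.coe_ne_top _)]
  -- With the positive factor moved to the left, the right side is an infimum over all τ and all
  -- eigenvalues t, so neither a minimiser nor the existence of an eigenvalue is needed.
  refine le_iInf fun τ => le_iInf₂ fun t ht => ?_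
  rw [EReal.div_le_iff_le_mul hpos (EReal.coe_ne_top _), ← EReal.coe_mul]
  exact MagneticWedge.limsup_groundEnergy_le B hB hB2 A hA ht
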